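/- Let $E$ be a real or complex normed vector space with a normalised (algebraic) basis $(e_i)_{i\in\mathbb N}$. For $x=\sum_i a_ie_i\in E$ (a finite sum) let $\operatorname{supp}(x)=\{i: a_i\neq 0\}$; write $k<x$, $x<n$, $x<y$ for $k<\min\operatorname{supp}(x)$, $\max\operatorname{supp}(x)<n$, $\max\operatorname{supp}(x)<\min\operatorname{supp}(y)$. Let $bb(e_i)\subseteq E^{\mathbb N}$ be the set of infinite normalised block sequences, i.e. sequences of norm-one vectors with $x_0<x_1<x_2<\cdots$. Here $E$ carries the standard Borel structure of the increasing union of its finite-dimensional subspaces $[e_0,\dots,e_n]$ (this is the Borel structure of the norm), and $\mathcal B\subseteq bb(e_i)$ is coanalytic if $bb(e_i)\setminus\mathcal B$ is an analytic subset of $E^{\mathbb N}$. Write $\Delta>0$ if $\Delta=(\delta_i)_{i\ge 0}$ is a decreasing sequence of strictly positive reals converging to $0$, and put $$\operatorname{Int}_\Delta(\mathcal B)=\{(y_i)\in bb(e_i) : \forall (x_i)\in bb(e_i)\ \big(\forall i\ \|x_i-y_i\|<\delta_i\ \Rightarrow\ (x_i)\in\mathcal B\big)\}.$$ For a strictly increasing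 sequence $(m_i)$ of natural numbers and $(x_i)\in bb(e_i)$, let $R(m_i,x_i)$ mean that for every $i$ there is $j$ with $m_0<x_i<m_j<m_{j+1}<x_{i+1}$. In the infinite asymptotic game (IAG), players I and II alternate, I beginning: I plays natural numbers $n_0,n_1,\dots$, and II plays normalised vectors $x_0<x_1<\cdots$ of $E$ with $n_i<x_i$; the outcome is $(x_i)$. A player has a strategy to play in $\mathcal A$ if he has a strategy forcing the outcome to lie in $\mathcal A$. A block tree is a non-empty set $T$ of finite normalised block sequences, closed under initial segments, such that for every $s\in T$ (including $s=\emptyset$) the set of $y$ with $s^\frown y\in T$ is $\{y_j\}_{j\in\mathbb N}$ for some $(y_j)\in bb(e_i)$ which, if $s\ne\emptyset$, satisfies $x<y_0$ for the last vector $x$ of $s$. Let $[T]$ be the set of $(x_i)\in bb(e_i)$ all of whose finite initial segments lie in $T$. **Theorem.** Let $\mathcal B\subseteq bb(e_i)$ be coanalytic. Then the following are equivalent: (d) there are $\Delta>0$ and a strictly increasing sequence $(m_i)$ of natural numbers such that every $(x_i)\in bb(e_i)$ with $R(m_i,x_i)$ lies in $\operatorname{Int}_\Delta(\mathcal B)$;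 (e) there is $\Delta>0$ such that I has a strategy in (IAG) to play in $\operatorname{Int}_\Delta(\mathcal B)$; (f) there is $\Delta>0$ such that $[T]\cap\operatorname{Int}_\Delta(\mathcal B)\neq\emptyset$ for every block tree $T$. Moreover, these perturbed games are determined in the following sense: exactly one of the following holds: (e), or, for every $\Delta>0$, II has a strategy in (IAG) to play in $bb(e_i)\setminus\operatorname{Int}_\Delta(\mathcal B)$. -/

import Mathlib

open Set Filter Topology MeasureTheory

namespace AsymptoticGame

variable {𝕜 E : Type*} [RCLike 𝕜] [NormedAddCommGroup E] [NormedSpace 𝕜 E]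

/-- The support of `x = ∑ aᵢ eᵢ` : the finite set of all `i` with `aᵢ ≠ 0`. -/
noncomputable def supp (e : Module.Basis ℕ 𝕜 E) (x : E) : Finset ℕ := (e.repr x).support

/-- `k < x`, that is `k < min supp x`. -/
def NatLt (e : Module.Basis ℕ 𝕜 E) (k : ℕ) (x : E) : Prop := ∀ i ∈ supp e x, k < i

/-- `x < n`, that is `max supp x < n`. -/
def LtNat (e : Module.Basis ℕ 𝕜 E) (x : E) (n : ℕ) : Prop := ∀ i ∈ supp e x, i < n

/-- `x < y`, that is `max supp x < min supp y`. -/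
def VecLt (e : Module.Basis ℕ 𝕜 E) (x y : E) : Prop :=
  ∀ i ∈ supp e x, ∀ j ∈ supp e y, i < j

/-- The set `bb(eᵢ)` of infinite normalised block sequences. -/
def bb (e : Module.Basis ℕ 𝕜 E) : Set (ℕ → E) :=
  {x | (∀ i, ‖x i‖ = 1) ∧ ∀ i, VecLt e (x i) (x (i + 1))}

/-- The set `fbb(eᵢ)` of finite normalised block sequences. -/
def fbb (e : Module.Basis ℕ 𝕜 E) : Set (List E) :=
  {s | (∀ x ∈ s, ‖x‖ = 1) ∧ s.IsChain (VecLt e)}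

/-- The finite sequence `(x₀, …, xₙ₋₁)`. -/
def initSeg {α : Type*} (x : ℕ → α) (n : ℕ) : List α := List.ofFn fun i : Fin n => x i

/-- `B ⊆ bb(eᵢ)` is coanalytic: its complement in `bb(eᵢ)` is analytic. Here `ℕ → E` carries the
product of the norm topologies. As `E` is the union of the finite-dimensional (closed, Polish)
spaces `[e₀, …, eₙ]`, the Borel sets of the norm topology are exactly those of the standard Borel
structure of this increasing union; `bb(eᵢ)` is a Borel subset of `ℕ → E`. -/
def IsCoanalytic (e : Module.Basis ℕ 𝕜 E) (B : Set (ℕ → E)) : Prop :=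
  AnalyticSet (bb e \ B)

/-- `Δ > 0`: a decreasing sequence of strictly positive reals converging to `0`. -/
def IsDelta (δ : ℕ → ℝ) : Prop :=
  Antitone δ ∧ (∀ i, 0 < δ i) ∧ Tendsto δ atTop (𝓝 0)

/-- The set `Int_Δ(A)`. -/
def IntDelta (e : Module.Basis ℕ 𝕜 E) (δ : ℕ → ℝ) (A : Set (ℕ → E)) : Set (ℕ → E) :=
  {y | y ∈ bb e ∧ ∀ x ∈ bb e, (∀ i, ‖x i - y i‖ < δ i) → x ∈ A}

/-- The relation `R(mᵢ, xᵢ)`: for all `i` there is `j` with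
`m₀ < xᵢ < mⱼ < mⱼ₊₁ < xᵢ₊₁`. -/
def RelR (e : Module.Basis ℕ 𝕜 E) (m : ℕ → ℕ) (x : ℕ → E) : Prop :=
  ∀ i, ∃ j, NatLt e (m 0) (x i) ∧ LtNat e (x i) (m j) ∧ m j < m (j + 1) ∧
    NatLt e (m (j + 1)) (x (i + 1))

/-- Player I has a strategy in the infinite asymptotic game to play in `A`. The strategy `σ`
gives I's next number from II's previous moves; every run of the game in which I follows `σ` and
II obeys the rules (normalised block vectors with `nₖ < xₖ`) has its outcome in `A`. -/
def StrategyI (e : Module.Basis ℕ 𝕜 E) (A : Set (ℕ → E)) : Prop :=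
  ∃ σ : List E → ℕ, ∀ x ∈ bb e, (∀ k, NatLt e (σ (initSeg x k)) (x k)) → x ∈ A

/-- Player II has a strategy in the infinite asymptotic game to play in `A`. The strategy `τ`
gives II's move `xₖ` from the numbers `(n₀, …, nₖ)` played by I; whatever I plays, II obeys the
rules and the outcome is in `A`. -/
def StrategyII (e : Module.Basis ℕ 𝕜 E) (A : Set (ℕ → E)) : Prop :=
  ∃ τ : List ℕ → E, ∀ n : ℕ → ℕ,
    (fun k => τ (initSeg n (k + 1))) ∈ bb e ∧
    (∀ k, NatLt e (n k) (τ (initSeg n (k + 1)))) ∧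
    (fun k => τ (initSeg n (k + 1))) ∈ A

/-- Block trees (of normalised vectors). The successors of every node, the root `∅` included, are
the terms of an infinite normalised block sequence lying beyond the last vector of the node. -/
structure IsBlockTree (e : Module.Basis ℕ 𝕜 E) (T : Set (List E)) : Prop where
  subset_fbb : T ⊆ fbb e
  nonempty : T.Nonempty
  mem_of_isPrefix : ∀ s ∈ T, ∀ t, t <+: s → t ∈ T
  successors : ∀ s ∈ T, ∃ y ∈ bb e, {v | s ++ [v] ∈ T} = range y ∧
    ∀ v ∈ s.getLast?, VecLt e v (y 0)

/-- The set `[T]` of infinite branches of `T`. -/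
def branches (e : Module.Basis ℕ 𝕜 E) (T : Set (List E)) : Set (ℕ → E) :=
  {x | x ∈ bb e ∧ ∀ n, initSeg x n ∈ T}

end AsymptoticGame

/-! A play for I meets every block tree, and avoiding all branches in a set lets II win along the
tree; the content is the dichotomy `exists_relR_or_exists_isBlockTree`. Write the complement of B as
the range of a continuous f on Baire space, and replace vectors by nets `D i` that have finitely
many elements below each n. Ask whether lower bounds M can prevent every net sequence d from having
a witness κ with f κ close to d.

If some M does, finiteness of the nets turns M into a sequence m (`exists_strictMono_bound`), and
every sequence spread out along m is too far from the complement of B.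

If no M does, the player choosing vectors can force an unavoidable pair (s, t) to grow to one with a
longer t (`Unavoidable.exists_forcing`), which is an open game and so needs only elementary
determinacy. Iterating gives a block tree each of whose branches x carries some κ; continuity of f
gives f κ close to x, so x is not in the interior. -/

namespace AsymptoticGame

/-! ### Initial segments and recursion -/

section Sequences

variable {α : Type*}

@[simp] lemma initSeg_zero (x : ℕ → α) : initSeg x 0 = [] := rfl

@[simp] lemma length_initSeg (x : ℕ → α) (n : ℕ) : (initSeg x n).length = n := by
  simp [initSeg]

lemma initSeg_succ (x : ℕ → α) (n : ℕ) : initSeg x (n + 1) = initSeg x n ++ [x n] := by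
  rw [initSeg, List.ofFn_succ', List.concat_eq_append]
  rfl

lemma initSeg_congr {x y : ℕ → α} {n : ℕ} (h : ∀ i < n, x i = y i) :
    initSeg x n = initSeg y n := by
  simp only [initSeg]
  congr 1
  ext i
  exact h i i.2

lemma eq_of_initSeg_eq {x y : ℕ → α} {n : ℕ} (h : initSeg x n = initSeg y n) {i : ℕ}
    (hi : i < n) : x i = y i := by
  have := congrFun (List.ofFn_injective h) ⟨i, hi⟩
  simpa using this

lemma take_initSeg (x : ℕ → α) {i n : ℕ} (h : i ≤ n) : (initSeg x n).take i = initSeg x i := by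
  apply List.ext_getElem
  · simp [h]
  · intro j h1 h2
    simp [initSeg]

lemma getElem_initSeg (x : ℕ → α) {i n : ℕ} (h : i < (initSeg x n).length) :
    (initSeg x n)[i] = x i := by
  simp [initSeg]

/-- Every rule giving the next term from the previous ones generates a sequence. -/
lemma exists_seq_eq (F : List α → α) : ∃ x : ℕ → α, ∀ k, x k = F (initSeg x k) := by
  let L : ℕ → List α := fun k => Nat.rec [] (fun _ l => l ++ [F l]) k
  refine ⟨fun k => F (L k), fun k => ?_⟩
  have : ∀ k, initSeg (fun k => F (L k)) k = L k := by
    intro k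
    induction k with
    | zero => rfl
    | succ k ih => rw [initSeg_succ, ih]
  rw [this]

end Sequences

variable {𝕜 E : Type*} [RCLike 𝕜] [NormedAddCommGroup E] [NormedSpace 𝕜 E]
  {e : Module.Basis ℕ 𝕜 E}

/-! ### Supports of block vectors -/

section Blocks

lemma NatLt.mono {m n : ℕ} {x : E} (h : NatLt e n x) (hmn : m ≤ n) : NatLt e m x :=
  fun i hi => hmn.trans_lt (h i hi)

lemma supp_nonempty {x : E} (hx : ‖x‖ = 1) : (supp e x).Nonempty := by
  rw [supp, Finsupp.support_nonempty_iff]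
  intro h
  rw [map_eq_zero_iff _ e.repr.injective] at h
  simp [h] at hx

lemma exists_ltNat (e : Module.Basis ℕ 𝕜 E) (x : E) : ∃ n, LtNat e x n := by
  obtain ⟨n, hn⟩ := (supp e x).bddAbove
  exact ⟨n + 1, fun i hi => Nat.lt_succ_of_le (hn hi)⟩

lemma LtNat.vecLt {x y : E} {n : ℕ} (hx : LtNat e x n) (hy : NatLt e n y) : VecLt e x y :=
  fun i hi j hj => (hx i hi).trans (hy j hj)

lemma VecLt.ltNat {x y : E} {n : ℕ} (h : VecLt e x y) (hy : ‖y‖ = 1) (hn : LtNat e y n) :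
    LtNat e x n := by
  obtain ⟨j, hj⟩ := supp_nonempty (e := e) hy
  exact fun i hi => (h i hi j hj).trans (hn j hj)

lemma le_of_mem_supp {x : ℕ → E} (hx : x ∈ bb e) (i : ℕ) : ∀ l ∈ supp e (x i), i ≤ l := by
  induction i with
  | zero => exact fun l _ => Nat.zero_le l
  | succ i ih =>
    intro l hl
    obtain ⟨j, hj⟩ := supp_nonempty (e := e) (hx.1 i)
    exact (ih j hj).trans_lt (hx.2 i j hj l hl)

lemma ltNat_of_le {x : ℕ → E} (hx : x ∈ bb e) {n i l : ℕ} (hli : l ≤ i)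
    (h : LtNat e (x i) n) : LtNat e (x l) n := by
  induction i, hli using Nat.le_induction with
  | base => exact h
  | succ i _ ih => exact ih ((hx.2 i).ltNat (hx.1 _) h)

lemma exists_natLt {x : ℕ → E} (hx : x ∈ bb e) (n : ℕ) : NatLt e n (x (n + 1)) :=
  fun l hl => le_of_mem_supp hx (n + 1) l hl

end Blocks

/-! ### Block trees and strategies -/

section Trees

lemma IsBlockTree.nil_mem {T : Set (List E)} (hT : IsBlockTree e T) : [] ∈ T := by
  obtain ⟨s, hs⟩ := hT.nonempty
  exact hT.mem_of_isPrefix s hs [] s.nil_prefix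

lemma IsBlockTree.exists_next {T : Set (List E)} (hT : IsBlockTree e T) :
    ∃ next : List E → ℕ → E, ∀ s ∈ T, ∀ n, s ++ [next s n] ∈ T ∧ NatLt e n (next s n) := by
  have : ∀ s : List E, ∀ n : ℕ, ∃ v : E, s ∈ T → s ++ [v] ∈ T ∧ NatLt e n v := by
    intro s n
    by_cases hs : s ∈ T
    · obtain ⟨y, hy, hr, -⟩ := hT.successors s hs
      refine ⟨y (n + 1), fun _ => ⟨?_, exists_natLt hy n⟩⟩
      have : y (n + 1) ∈ {v | s ++ [v] ∈ T} := hr ▸ mem_range_self _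
      exact this
    · exact ⟨0, fun h => absurd h hs⟩
  choose next hnext using this
  exact ⟨next, fun s hs n => hnext s n hs⟩

lemma mem_bb_of_initSeg_mem_fbb {x : ℕ → E} (h : ∀ n, initSeg x n ∈ fbb e) : x ∈ bb e := by
  refine ⟨fun i => (h (i + 1)).1 _ (by simp [initSeg_succ]), fun i => ?_⟩
  have := (h (i + 2)).2
  rw [initSeg_succ, initSeg_succ, List.append_assoc, List.isChain_append] at this
  simpa using this.2.1

lemma IsBlockTree.mem_branches {T : Set (List E)} (hT : IsBlockTree e T) {x : ℕ → E}
    (h : ∀ n, initSeg x n ∈ T) : x ∈ branches e T :=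
  ⟨mem_bb_of_initSeg_mem_fbb fun n => hT.subset_fbb (h n), h⟩

/-- A strategy for I meets every block tree. -/
lemma StrategyI.branches_inter_nonempty {A : Set (ℕ → E)} (hA : StrategyI e A)
    {T : Set (List E)} (hT : IsBlockTree e T) : (branches e T ∩ A).Nonempty := by
  obtain ⟨σ, hσ⟩ := hA
  obtain ⟨next, hnext⟩ := hT.exists_next
  obtain ⟨x, hx⟩ := exists_seq_eq fun s => next s (σ s)
  have hmem : ∀ n, initSeg x n ∈ T := by
    intro n
    induction n with
    | zero => exact hT.nil_mem
    | succ n ih => rw [initSeg_succ, hx n]; exact (hnext _ ih _).1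
  have hb := hT.mem_branches hmem
  refine ⟨x, hb, hσ x hb.1 fun k => ?_⟩
  have := (hnext _ (hmem k) (σ (initSeg x k))).2
  rwa [← hx k] at this

/-- II can play along a block tree. -/
lemma IsBlockTree.strategyII {T : Set (List E)} (hT : IsBlockTree e T) {A : Set (ℕ → E)}
    (h : branches e T ⊆ A) : StrategyII e A := by
  obtain ⟨next, hnext⟩ := hT.exists_next
  let pos : List ℕ → List E := fun l => l.foldl (fun s n => s ++ [next s n]) []
  have hpos : ∀ l n, pos (l ++ [n]) = pos l ++ [next (pos l) n] := by
    intro l n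
    simp [pos, List.foldl_append]
  refine ⟨fun l => (pos l).getLastD 0, fun n => ?_⟩
  have hlast : ∀ k, (pos (initSeg n (k + 1))).getLastD 0 = next (pos (initSeg n k)) (n k) := by
    intro k
    rw [initSeg_succ, hpos]
    simp
  have hseg : ∀ k, initSeg (fun k => (pos (initSeg n (k + 1))).getLastD 0) k =
      pos (initSeg n k) := by
    intro k
    induction k with
    | zero => rfl
    | succ k ih => rw [initSeg_succ, ih, hlast, initSeg_succ, hpos]
  have hmem : ∀ k, pos (initSeg n k) ∈ T := by
    intro k
    induction k with
    | zero => exact hT.nil_mem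
    | succ k ih => rw [initSeg_succ, hpos]; exact (hnext _ ih _).1
  have hb : (fun k => (pos (initSeg n (k + 1))).getLastD 0) ∈ branches e T :=
    hT.mem_branches fun k => by rw [hseg]; exact hmem k
  refine ⟨hb.1, fun k => ?_, h hb⟩
  beta_reduce
  rw [hlast]
  exact (hnext _ (hmem k) _).2

/-- The two players cannot both have winning strategies. -/
lemma StrategyI.not_strategyII {A : Set (ℕ → E)} (hA : StrategyI e A) :
    ¬ StrategyII e (bb e \ A) := by
  rintro ⟨τ, hτ⟩
  obtain ⟨σ, hσ⟩ := hA
  -- Play σ against τ: the numbers played so far determine II's replies through their prefixes, and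
  -- σ answers these.
  obtain ⟨n, hn⟩ := exists_seq_eq fun l : List ℕ =>
    σ (initSeg (fun i => τ (l.take (i + 1))) l.length)
  obtain ⟨h1, h2, h3⟩ := hτ n
  refine h3.2 (hσ _ h1 fun k => ?_)
  have hk : initSeg (fun i => τ ((initSeg n k).take (i + 1))) (initSeg n k).length =
      initSeg (fun k => τ (initSeg n (k + 1))) k := by
    rw [length_initSeg]
    refine initSeg_congr fun i hi => ?_
    rw [take_initSeg n (Nat.succ_le_of_lt hi)]
  have := h2 k
  rw [hn k, hk] at this
  exact this

/-- A set of vectors is unbounded if it has elements arbitrarily far out. -/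
def Unbounded (e : Module.Basis ℕ 𝕜 E) (S : Set E) : Prop := ∀ n, ∃ x ∈ S, NatLt e n x

lemma Unbounded.exists_bb {S : Set E} (hS : Unbounded e S) (hnorm : ∀ x ∈ S, ‖x‖ = 1) (N : ℕ) :
    ∃ y ∈ bb e, (∀ i, y i ∈ S) ∧ ∀ i, NatLt e N (y i) := by
  choose p hpS hp using hS
  choose b hb using exists_ltNat e
  obtain ⟨y, hy⟩ := exists_seq_eq fun s : List E => p (max N (b (s.getLastD 0)))
  refine ⟨y, ⟨fun i => ?_, fun i => ?_⟩, fun i => ?_, fun i => ?_⟩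
  · rw [hy i]; exact hnorm _ (hpS _)
  · have h := hp (max N (b ((initSeg y (i + 1)).getLastD 0)))
    rw [← hy (i + 1)] at h
    rw [initSeg_succ] at h
    simp only [List.getLastD_concat] at h
    exact (hb (y i)).vecLt (h.mono (le_max_right _ _))
  · rw [hy i]; exact hpS _
  · rw [hy i]; exact (hp _).mono (le_max_left _ _)

/-- A tree all of whose nodes have unboundedly many successors contains a block tree. -/
lemma exists_isBlockTree {c : List E → Set E} (hc : ∀ v, Unbounded e (c v))
    (hnorm : ∀ v, ∀ x ∈ c v, ‖x‖ = 1) :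
    ∃ T, IsBlockTree e T ∧ ∀ x ∈ branches e T, ∀ i, x i ∈ c (initSeg x i) := by
  choose b hb using exists_ltNat e
  choose y hy hyc hyN using fun v => (hc v).exists_bb (hnorm v) (b (v.getLastD 0))
  have hlast : ∀ v : List E, ∀ i, ∀ w ∈ v.getLast?, VecLt e w (y v i) := by
    intro v i w hw
    have : v.getLastD 0 = w := by
      rw [List.getLastD_eq_getLast?, Option.mem_def.1 hw]; rfl
    have h := hyN v i
    rw [this] at h
    exact (hb w).vecLt h
  let T : Set (List E) := {s | ∀ t x, t ++ [x] <+: s → x ∈ range (y t)}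
  have hsucc : ∀ s v, s ++ [v] ∈ T ↔ s ∈ T ∧ v ∈ range (y s) := by
    intro s v
    constructor
    · exact fun h => ⟨fun t x ht => h t x (ht.trans (s.prefix_append [v])),
        h s v (List.prefix_refl _)⟩
    · rintro ⟨h1, h2⟩ t x ht
      rcases List.prefix_concat_iff.1 ht with h | h
      · obtain ⟨h3, h4⟩ := List.append_inj' h rfl
        rw [h3, List.singleton_inj.1 h4]; exact h2
      · exact h1 t x h
  refine ⟨T, ⟨?_, ⟨[], ?_⟩, ?_, ?_⟩, ?_⟩
  · intro s
    induction s using List.reverseRecOn with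
    | nil => exact fun _ => ⟨by simp, List.isChain_nil⟩
    | append_singleton s v ih =>
      intro h
      obtain ⟨h1, i, rfl⟩ := (hsucc _ _).1 h
      obtain ⟨h3, h4⟩ := ih h1
      refine ⟨fun x hx => ?_, ?_⟩
      · rcases List.mem_append.1 hx with hx | hx
        · exact h3 x hx
        · rw [List.mem_singleton.1 hx]; exact (hy s).1 i
      · rw [List.isChain_append]
        refine ⟨h4, List.isChain_singleton _, fun x hx z hz => ?_⟩
        simp only [List.head?_cons, Option.mem_def, Option.some.injEq] at hz
        rw [← hz]
        exact hlast s i x hx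
  · intro t x h
    exact absurd h (by simp)
  · exact fun s hs t ht u x hu => hs u x (hu.trans ht)
  · refine fun s hs => ⟨y s, hy s, ?_, fun v hv => hlast s 0 v hv⟩
    ext v
    simp only [mem_ofPred_eq, hsucc, hs, true_and]
  · intro x hx i
    have := hx.2 (i + 1)
    rw [initSeg_succ, hsucc] at this
    obtain ⟨j, hj⟩ := this.2
    rw [← hj]
    exact hyc _ j

end Trees

/-! ### Forcing a witness along the play -/

section Unfolding

variable (e) (D : ℕ → Set E) (P : (ℕ → E) → (ℕ → ℕ) → Prop)

/-- A pair `(s, t)` is unavoidable if, whatever lower bounds `M` are imposed on the vectors after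
`s`, some block sequence of vectors in the `D i` extends `s`, obeys `M`, and has a witness for `P`
extending `t`. -/
def Unavoidable (s : List E) (t : List ℕ) : Prop :=
  ∀ M : List E → ℕ, ∃ d ∈ bb e, (∀ i, d i ∈ D i) ∧ initSeg d s.length = s ∧
    (∀ i, s.length ≤ i → NatLt e (M (initSeg d i)) (d i)) ∧
    ∃ κ, initSeg κ t.length = t ∧ P d κ

/-- The player choosing vectors can force the play from `s` to meet `W`. -/
def CanReach (W : List E → Prop) (s : List E) : Prop :=
  ∃ c : List E → Set E, (∀ v, c v ⊆ D v.length ∧ Unbounded e (c v)) ∧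
    ∀ d : ℕ → E, initSeg d s.length = s → (∀ i, s.length ≤ i → d i ∈ c (initSeg d i)) →
      ∃ i, s.length ≤ i ∧ W (initSeg d i)

variable {e D P}

lemma CanReach.of_mem (hD : ∀ i, Unbounded e (D i)) {W : List E → Prop} {s : List E} (h : W s) :
    CanReach e D W s :=
  ⟨fun v => D v.length, fun _ => ⟨Subset.rfl, hD _⟩,
    fun d hd _ => ⟨s.length, le_rfl, by rwa [hd]⟩⟩

lemma exists_forcing_of_unbounded (hD : ∀ i, Unbounded e (D i)) {W : List E → Prop} {s : List E}
    (h : Unbounded e {x ∈ D s.length | CanReach e D W (s ++ [x])}) :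
    ∃ c : List E → Set E, (∀ v, c v ⊆ D v.length ∧ Unbounded e (c v)) ∧
    ∀ d : ℕ → E, initSeg d s.length = s → (∀ i, s.length ≤ i → d i ∈ c (initSeg d i)) →
      ∃ i, s.length < i ∧ W (initSeg d i) := by
  classical
  have : ∀ x : E, ∃ c : List E → Set E, (∀ v, c v ⊆ D v.length ∧ Unbounded e (c v)) ∧
      (CanReach e D W (s ++ [x]) → ∀ d : ℕ → E, initSeg d (s.length + 1) = s ++ [x] →
        (∀ i, s.length + 1 ≤ i → d i ∈ c (initSeg d i)) →
        ∃ i, s.length + 1 ≤ i ∧ W (initSeg d i)) := by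
    intro x
    by_cases hx : CanReach e D W (s ++ [x])
    · obtain ⟨c, hc, h⟩ := hx
      refine ⟨c, hc, fun _ d h1 h2 => ?_⟩
      simpa using h d (by simpa using h1) (by simpa using h2)
    · exact ⟨fun v => D v.length, fun _ => ⟨Subset.rfl, hD _⟩, fun h => absurd h hx⟩
  choose c hc hcW using this
  -- First move to a winning successor x of s; afterwards the entry of v at index `s.length`
  -- recovers x and selects its forcing system.
  refine ⟨fun v => if v.length = s.length then {x ∈ D s.length | CanReach e D W (s ++ [x])}
    else c (v.getD s.length 0) v, fun v => ?_, fun d hd hdc => ?_⟩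
  · by_cases hv : v.length = s.length
    · simp only [hv, if_true]
      exact ⟨sep_subset _ _, h⟩
    · simp only [hv, if_false]
      exact hc _ _
  · have h0 := hdc s.length le_rfl
    simp only [length_initSeg, if_true] at h0
    refine hcW (d s.length) h0.2 d (by rw [initSeg_succ, hd]) fun i hi => ?_
    have h1 := hdc i (by omega)
    beta_reduce at h1
    rw [length_initSeg, if_neg (by omega)] at h1
    rwa [List.getD_eq_getElem _ _ (by simpa using hi), getElem_initSeg] at h1

/-- Otherwise winning successors exist arbitrarily far out, and their forcing systems glue to one
from s. Thus the opponent can preserve a non-winning position by imposing a single lower bound. -/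
lemma exists_bound_of_not_canReach (hD : ∀ i, Unbounded e (D i)) {W : List E → Prop}
    {s : List E} (h : ¬ CanReach e D W s) :
    ∃ N, ∀ x ∈ D s.length, NatLt e N x → ¬ CanReach e D W (s ++ [x]) := by
  by_contra! H
  obtain ⟨c, hc, hW⟩ := exists_forcing_of_unbounded (W := W) (s := s) hD fun n => by
    obtain ⟨x, h1, h2, h3⟩ := H n
    exact ⟨x, ⟨h1, h3⟩, h2⟩
  refine h ⟨c, hc, fun d h1 h2 => ?_⟩
  obtain ⟨i, hi, hw⟩ := hW d h1 h2
  exact ⟨i, hi.le, hw⟩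

/-- From an unavoidable pair one can force to reach an unavoidable pair with a longer witness. -/
lemma Unavoidable.exists_forcing (hD : ∀ i, Unbounded e (D i)) {s : List E} {t : List ℕ}
    (h : Unavoidable e D P s t) :
    ∃ c : List E → Set E, (∀ v, c v ⊆ D v.length ∧ Unbounded e (c v)) ∧
    ∀ d : ℕ → E, initSeg d s.length = s → (∀ i, s.length ≤ i → d i ∈ c (initSeg d i)) →
      ∃ i, s.length < i ∧ ∃ k ≤ (initSeg d i).length,
        Unavoidable e D P (initSeg d i) (t ++ [k]) := by
  set W : List E → Prop := fun v => ∃ k ≤ v.length, Unavoidable e D P v (t ++ [k]) with hWdef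
  refine exists_forcing_of_unbounded (W := W) hD ?_
  by_contra hb
  simp only [Unbounded, not_forall, not_exists, not_and, mem_ofPred_eq] at hb
  obtain ⟨N₀, hN₀⟩ := hb
  have hN : ∀ v : List E, ∃ N, ¬ CanReach e D W v →
      ∀ x ∈ D v.length, NatLt e N x → ¬ CanReach e D W (v ++ [x]) := by
    intro v
    by_cases hv : CanReach e D W v
    · exact ⟨0, fun h => absurd hv h⟩
    · obtain ⟨N, hN⟩ := exists_bound_of_not_canReach hD hv
      exact ⟨N, fun _ => hN⟩
  choose N hN using hN
  have hM : ∀ (v : List E) (k : ℕ), ∃ M : List E → ℕ, ¬ Unavoidable e D P v (t ++ [k]) →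
      ¬ ∃ d ∈ bb e, (∀ i, d i ∈ D i) ∧ initSeg d v.length = v ∧
        (∀ i, v.length ≤ i → NatLt e (M (initSeg d i)) (d i)) ∧
        ∃ κ, initSeg κ (t ++ [k]).length = t ++ [k] ∧ P d κ := by
    intro v k
    by_cases hv : Unavoidable e D P v (t ++ [k])
    · exact ⟨0, fun h => absurd hv h⟩
    · rw [Unavoidable, not_forall] at hv
      obtain ⟨M, hM⟩ := hv
      exact ⟨M, fun _ => hM⟩
  choose M hM using hM
  -- These bounds keep the play away from W and also obey every refuting M attached to an earlier
  -- position and a candidate k. Requiring k to be at most the length of the position keeps this a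
  -- finite maximum.
  obtain ⟨d, hd, hdD, hds, hdM, κ, hκ, hP⟩ := h fun v => max (max N₀ (N v))
    ((Finset.range (v.length + 1)).sup fun i =>
      (Finset.range (i + 1)).sup fun k => M (v.take i) k v)
  have hnot : ∀ i, s.length + 1 ≤ i → ¬ CanReach e D W (initSeg d i) := by
    intro i hi
    induction i, hi using Nat.le_induction with
    | base =>
      rw [initSeg_succ]
      have h1 := hdM s.length le_rfl
      have h2 := hN₀ (d s.length)
      rw [hds] at h1 ⊢
      exact fun h3 => h2 ⟨hdD _, h3⟩ (h1.mono ((le_max_left _ _).trans (le_max_left _ _)))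
    | succ i hi ih =>
      rw [initSeg_succ]
      exact hN _ ih _ (by rw [length_initSeg]; exact hdD i)
        ((hdM i (by omega)).mono ((le_max_right _ _).trans (le_max_left _ _)))
  set k := κ t.length with hk
  set i := max k (s.length + 1) with hi
  have hWi : ¬ W (initSeg d i) := fun hw => hnot i (le_max_right _ _) (CanReach.of_mem hD hw)
  have hU : ¬ Unavoidable e D P (initSeg d i) (t ++ [k]) := fun hU =>
    hWi ⟨k, by rw [length_initSeg]; exact le_max_left _ _, hU⟩
  refine hM _ _ hU ⟨d, hd, hdD, by rw [length_initSeg], fun l hl => ?_, κ, ?_, hP⟩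
  · rw [length_initSeg] at hl
    refine (hdM l ?_).mono (le_trans ?_ (le_max_right _ _))
    · have : s.length + 1 ≤ i := le_max_right _ _
      omega
    · rw [← take_initSeg d hl]
      refine le_trans ?_ (Finset.le_sup (f := fun i => (Finset.range (i + 1)).sup fun k =>
        M ((initSeg d l).take i) k (initSeg d l)) (b := i) ?_)
      · refine Finset.le_sup (f := fun k => M ((initSeg d l).take i) k (initSeg d l)) ?_
        rw [Finset.mem_range, Nat.lt_succ_iff]
        exact le_max_left _ _
      · rw [Finset.mem_range, Nat.lt_succ_iff, length_initSeg]
        exact hl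
  · rw [List.length_append, List.length_singleton, initSeg_succ, hκ]

open Classical in
variable (e D P) in
/-- The current unavoidable pair along a growing sequence of positions: it is updated whenever the
witness can be lengthened. -/
noncomputable def unavoidablePair (w : ℕ → List E) : ℕ → List E × List ℕ
  | 0 => ([], [])
  | n + 1 =>
    if h : ∃ k ≤ (w (n + 1)).length,
      Unavoidable e D P (w (n + 1)) ((unavoidablePair w n).2 ++ [k]) then
      (w (n + 1), (unavoidablePair w n).2 ++ [h.choose])
    else unavoidablePair w n

lemma unavoidablePair_congr {w w' : ℕ → List E} {n : ℕ} (h : ∀ i ≤ n, w i = w' i) :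
    unavoidablePair e D P w n = unavoidablePair e D P w' n := by
  induction n with
  | zero => rfl
  | succ n ih =>
    have h1 := ih fun i hi => h i (by omega)
    have h2 := h (n + 1) le_rfl
    simp only [unavoidablePair]
    generalize unavoidablePair e D P w n = a at h1 ⊢
    generalize w (n + 1) = b at h2 ⊢
    subst h1 h2
    rfl

/-- Always follow the forcing system of the current unavoidable pair, which then changes infinitely
often; the second coordinates grow to κ. -/
lemma exists_forcing_witness (hD : ∀ i, Unbounded e (D i)) (h : Unavoidable e D P [] []) :
    ∃ c : List E → Set E, (∀ v, c v ⊆ D v.length ∧ Unbounded e (c v)) ∧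
    ∀ d : ℕ → E, (∀ i, d i ∈ c (initSeg d i)) →
      ∃ κ : ℕ → ℕ, ∀ j, ∃ i, j ≤ i ∧ Unavoidable e D P (initSeg d i) (initSeg κ j) := by
  have : ∀ (s : List E) (t : List ℕ), ∃ c : List E → Set E,
      (∀ v, c v ⊆ D v.length ∧ Unbounded e (c v)) ∧ (Unavoidable e D P s t →
      ∀ d : ℕ → E, initSeg d s.length = s → (∀ i, s.length ≤ i → d i ∈ c (initSeg d i)) →
      ∃ i, s.length < i ∧ ∃ k ≤ (initSeg d i).length,
        Unavoidable e D P (initSeg d i) (t ++ [k])) := by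
    intro s t
    by_cases hst : Unavoidable e D P s t
    · obtain ⟨c, h1, h2⟩ := hst.exists_forcing hD
      exact ⟨c, h1, fun _ => h2⟩
    · exact ⟨fun v => D v.length, fun _ => ⟨Subset.rfl, hD _⟩, fun h => absurd h hst⟩
  choose c hc hcU using this
  refine ⟨fun v => c (unavoidablePair e D P (fun i => v.take i) v.length).1
    (unavoidablePair e D P (fun i => v.take i) v.length).2 v, fun v => hc _ _ v,
    fun d hd => ?_⟩
  set p := unavoidablePair e D P (initSeg d) with hp
  have hdc : ∀ i, d i ∈ c (p i).1 (p i).2 (initSeg d i) := by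
    intro i
    have h1 := hd i
    beta_reduce at h1
    rw [length_initSeg, unavoidablePair_congr (w' := initSeg d)
      fun j hj => take_initSeg d hj] at h1
    exact h1
  have step : ∀ n, (p n).1 = initSeg d n → Unavoidable e D P (p n).1 (p n).2 →
      ∃ i, n < i ∧ (p i).1 = initSeg d i ∧ Unavoidable e D P (p i).1 (p i).2 ∧
        ∃ k, (p i).2 = (p n).2 ++ [k] := by
    intro n hn hU
    have hconst : ∀ m, n ≤ m → (∀ i, n < i → i ≤ m → ¬ ∃ k ≤ (initSeg d i).length,
        Unavoidable e D P (initSeg d i) ((p n).2 ++ [k])) → p m = p n := by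
      intro m hm
      induction m, hm using Nat.le_induction with
      | base => exact fun _ => rfl
      | succ m hm ih =>
        intro H
        have hpm := ih fun i h1 h2 => H i h1 (by omega)
        have hH := H (m + 1) (by omega) le_rfl
        rw [← hpm] at hH
        rw [← hpm, hp, unavoidablePair, dif_neg hH]
    -- Without an update the pair stays constant, so d follows one forcing system from n on, which
    -- guarantees an update.
    have hex : ∃ i, n < i ∧ ∃ k ≤ (initSeg d i).length,
        Unavoidable e D P (initSeg d i) ((p n).2 ++ [k]) := by
      by_contra H
      push Not at H
      have hlen : (p n).1.length = n := by rw [hn, length_initSeg]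
      obtain ⟨i, hi, k, hk, hk'⟩ := hcU _ _ hU d (by rw [hlen, hn]) fun i hi => by
        rw [hlen] at hi
        have h1 := hdc i
        rwa [hconst i hi fun j h1 _ => by push Not; exact H j h1] at h1
      exact H i (by omega) k hk hk'
    classical
    obtain ⟨hlt, hW⟩ := Nat.find_spec hex
    have hmin := fun i => Nat.find_min (m := i) hex
    set i := Nat.find hex with hi
    obtain ⟨m, hm⟩ : ∃ m, i = m + 1 := ⟨i - 1, by omega⟩
    rw [hm] at hlt hW hmin
    have hpm := hconst m (by omega) fun j h1 h2 h3 => hmin j (by omega) ⟨h1, h3⟩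
    rw [← hpm] at hW
    have hpi : p (m + 1) = (initSeg d (m + 1), (p m).2 ++ [hW.choose]) := dif_pos hW
    refine ⟨m + 1, hlt, ?_, ?_, hW.choose, ?_⟩
    · rw [hpi]
    · rw [hpi]; exact hW.choose_spec.2
    · rw [← hpm, hpi]
  let X := {n // (p n).1 = initSeg d n ∧ Unavoidable e D P (p n).1 (p n).2}
  have step' : ∀ a : X, ∃ b : X, a.1 < b.1 ∧ ∃ k, (p b.1).2 = (p a.1).2 ++ [k] := by
    rintro ⟨n, h1, h2⟩
    obtain ⟨i, h3, h4, h5, h6⟩ := step n h1 h2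
    exact ⟨⟨i, h4, h5⟩, h3, h6⟩
  choose next hlt κ hκ using step'
  let a : ℕ → X := fun j => Nat.rec ⟨0, rfl, h⟩ (fun _ => next) j
  have ha : ∀ j, initSeg (fun j => κ (a j)) j = (p (a j).1).2 := by
    intro j
    induction j with
    | zero => rfl
    | succ j ih => rw [initSeg_succ, ih]; exact (hκ (a j)).symm
  have hle : ∀ j, j ≤ (a j).1 := by
    intro j
    induction j with
    | zero => exact Nat.zero_le _
    | succ j ih => exact Nat.succ_le_of_lt (ih.trans_lt (hlt (a j)))
  refine ⟨fun j => κ (a j), fun j => ⟨(a j).1, hle j, ?_⟩⟩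
  rw [ha j, ← (a j).2.1]
  exact (a j).2.2

end Unfolding

/-! ### Finite nets of given support -/

section Nets

lemma exists_finite_net_supp (e : Module.Basis ℕ 𝕜 E) (F : Finset ℕ) {ε : ℝ} (hε : 0 < ε) :
    ∃ G : Set E, G.Finite ∧ G ⊆ {x | ‖x‖ = 1 ∧ supp e x = F} ∧
      ∀ x, ‖x‖ = 1 → supp e x = F → ∃ y ∈ G, ‖x - y‖ < ε := by
  let V : Submodule 𝕜 E := Submodule.span 𝕜 (e '' F)
  have : FiniteDimensional 𝕜 V := FiniteDimensional.span_of_finite 𝕜 (F.finite_toSet.image e)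
  have : ProperSpace V := FiniteDimensional.proper_rclike 𝕜 V
  have hK : IsCompact ((↑) '' Metric.closedBall (0 : V) 1 : Set E) :=
    (isCompact_closedBall (0 : V) 1).image continuous_subtype_val
  have hsub : {x | ‖x‖ = 1 ∧ supp e x = F} ⊆ ((↑) '' Metric.closedBall (0 : V) 1 : Set E) := by
    rintro x ⟨h1, h2⟩
    have hx : x ∈ V := by
      have := e.mem_span_repr_support x
      rwa [show (e.repr x).support = F from h2] at this
    exact ⟨⟨x, hx⟩, by simp [h1], rfl⟩
  obtain ⟨G, hG, hfin, hcov⟩ := (hK.totallyBounded.subset hsub).exists_subset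
    (Metric.dist_mem_uniformity hε)
  refine ⟨G, hfin, hG, fun x h1 h2 => ?_⟩
  have := hcov (show x ∈ {x | ‖x‖ = 1 ∧ supp e x = F} from ⟨h1, h2⟩)
  simp only [mem_iUnion, mem_ofPred_eq] at this
  obtain ⟨y, hy, h⟩ := this
  exact ⟨y, hy, by rwa [← dist_eq_norm]⟩

/-- A set of normalised vectors, finitely many below each `n`, that approximates every normalised
vector by one with the same support. -/
lemma exists_net (e : Module.Basis ℕ 𝕜 E) {ε : ℝ} (hε : 0 < ε) :
    ∃ D : Set E, (∀ x ∈ D, ‖x‖ = 1) ∧ (∀ n, {x ∈ D | LtNat e x n}.Finite) ∧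
      ∀ x, ‖x‖ = 1 → ∃ y ∈ D, supp e y = supp e x ∧ ‖x - y‖ < ε := by
  choose G hfin hG hcov using fun F => exists_finite_net_supp e F hε
  refine ⟨⋃ F, G F, fun x hx => ?_, fun n => ?_, fun x hx => ?_⟩
  · obtain ⟨F, hF⟩ := mem_iUnion.1 hx
    exact (hG F hF).1
  · refine ((Finset.range n).powerset.finite_toSet.biUnion fun F _ => hfin F).subset ?_
    rintro x ⟨hx, hxn⟩
    obtain ⟨F, hF⟩ := mem_iUnion.1 hx
    refine mem_biUnion ?_ hF
    rw [Finset.mem_coe, Finset.mem_powerset, ← (hG F hF).2]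
    exact fun i hi => Finset.mem_range.2 (hxn i hi)
  · obtain ⟨y, hy, h⟩ := hcov _ x hx rfl
    exact ⟨y, mem_iUnion.2 ⟨_, hy⟩, (hG _ hy).2, h⟩

end Nets

/-! ### The dichotomy -/

section Main

/-- Only finitely many net positions lie below m j, so m (j+1) can dominate M on all of them; the
gap demanded by `RelR` then enforces M. -/
lemma exists_strictMono_bound {D : ℕ → Set E} (hfin : ∀ i n, {x ∈ D i | LtNat e x n}.Finite)
    (M : List E → ℕ) :
    ∃ m : ℕ → ℕ, StrictMono m ∧ ∀ d ∈ bb e, (∀ i, d i ∈ D i) → RelR e m d →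
      ∀ i, NatLt e (M (initSeg d i)) (d i) := by
  have hb : ∀ n, ∃ b, ∀ d : ℕ → E, ∀ k ≤ n, (∀ i < k, d i ∈ D i ∧ LtNat e (d i) n) →
      M (initSeg d k) ≤ b := by
    intro n
    have hF : (⋃ k ∈ Finset.range (n + 1), (fun g : Fin k → E => M (List.ofFn g)) ''
        Set.pi univ fun i => {x ∈ D i | LtNat e x n}).Finite :=
      (Finset.range (n + 1)).finite_toSet.biUnion fun k _ =>
        (Set.Finite.pi fun i => hfin _ n).image _
    obtain ⟨b, hb⟩ := hF.bddAbove
    refine ⟨b, fun d k hk hd => hb ?_⟩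
    simp only [mem_iUnion]
    exact ⟨k, Finset.mem_range.2 (by omega), fun i => d i, fun i _ => hd i i.2, rfl⟩
  choose b hb using hb
  let m : ℕ → ℕ := fun j => Nat.rec (M []) (fun _ n => max (n + 1) (b n)) j
  refine ⟨m, strictMono_nat_of_lt_succ fun j => le_max_left (m j + 1) (b (m j)), fun d hd hdD hR i => ?_⟩
  cases i with
  | zero =>
    obtain ⟨j, h, -⟩ := hR 0
    exact h
  | succ i =>
    obtain ⟨j, -, h1, -, h2⟩ := hR i
    refine h2.mono (le_trans ?_ (le_max_right _ _))
    refine hb (m j) d (i + 1) ?_ fun l hl => ⟨hdD l, ltNat_of_le hd (by omega) h1⟩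
    obtain ⟨l, hl⟩ := supp_nonempty (e := e) (hd.1 i)
    exact (le_of_mem_supp hd i l hl).trans_lt (h1 l hl)

/-- After each vector, I picks j with m j beyond it and plays m (j+1). -/
lemma strategyI_of_relR {A : Set (ℕ → E)} {m : ℕ → ℕ} (hm : StrictMono m)
    (h : ∀ x ∈ bb e, RelR e m x → x ∈ A) : StrategyI e A := by
  have hj : ∀ x : E, ∃ j, LtNat e x (m j) := by
    intro x
    obtain ⟨n, hn⟩ := exists_ltNat e x
    exact ⟨n, fun i hi => (hn i hi).trans_le (hm.id_le n)⟩
  choose j hj using hj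
  refine ⟨fun s => if s = [] then m 0 else m (j (s.getLastD 0) + 1), fun x hx hσ => ?_⟩
  have hsucc : ∀ i, NatLt e (m (j (x i) + 1)) (x (i + 1)) := by
    intro i
    have := hσ (i + 1)
    beta_reduce at this
    rw [initSeg_succ, if_neg (by simp)] at this
    simpa using this
  refine h x hx fun i => ⟨j (x i), ?_, hj _, hm (Nat.lt_succ_self _), hsucc i⟩
  cases i with
  | zero => simpa using hσ 0
  | succ i => exact (hsucc i).mono (hm.monotone (Nat.zero_le _))

/-- Either all sequences satisfying `R(mᵢ, xᵢ)` lie in some `Int_Δ(B)`, or for every `Δ` some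
block tree has no branch in `Int_Δ(B)`. -/
lemma exists_relR_or_exists_isBlockTree {B : Set (ℕ → E)} (hBco : IsCoanalytic e B)
    (he : ∀ i, ‖e i‖ = 1) {δ : ℕ → ℝ} (hδ : IsDelta δ) :
    (∃ m : ℕ → ℕ, StrictMono m ∧
      ∀ x ∈ bb e, RelR e m x → x ∈ IntDelta e (fun i => δ i / 4) B) ∨
    ∃ T, IsBlockTree e T ∧ branches e T ⊆ bb e \ IntDelta e δ B := by
  rw [IsCoanalytic, AnalyticSet] at hBco
  rcases hBco with hB | ⟨f, hf, hfB⟩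
  · exact Or.inl ⟨id, strictMono_id, fun x hx _ => ⟨hx, fun z hz _ => sdiff_eq_empty.1 hB hz⟩⟩
  choose D hnorm hfin happ using fun i => exists_net e (show 0 < δ i / 4 by linarith [hδ.2.1 i])
  have happ' : ∀ i x, ∃ y, ‖x‖ = 1 → y ∈ D i ∧ supp e y = supp e x ∧ ‖x - y‖ < δ i / 4 := by
    intro i x
    by_cases hx : ‖x‖ = 1
    · obtain ⟨y, hy⟩ := happ i x hx
      exact ⟨y, fun _ => hy⟩
    · exact ⟨0, fun h => absurd h hx⟩
  choose π hπ using happ'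
  -- The radius δ/2 absorbs the δ/4 perturbation plus the δ/4 net error; the non-strict inequality
  -- survives limits and still gives < δ.
  let P : (ℕ → E) → (ℕ → ℕ) → Prop := fun d κ => ∀ i, ‖f κ i - d i‖ ≤ δ i / 2
  by_cases hU : Unavoidable e D P [] []
  · right
    have hD : ∀ i, Unbounded e (D i) := by
      intro i n
      obtain ⟨y, hy, hs, -⟩ := happ i (e (n + 1)) (he _)
      refine ⟨y, hy, fun j hj => ?_⟩
      rw [hs, supp, Module.Basis.repr_self] at hj
      rw [Finset.mem_singleton.1 (Finsupp.support_single_subset hj)]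
      exact Nat.lt_succ_self n
    obtain ⟨c, hc, hκ⟩ := exists_forcing_witness hD hU
    obtain ⟨T, hT, hTc⟩ := exists_isBlockTree (fun v => (hc v).2)
      fun v x hx => hnorm _ x ((hc v).1 hx)
    refine ⟨T, hT, fun x hx => ⟨hx.1, fun hint => ?_⟩⟩
    obtain ⟨κ, hκ⟩ := hκ x (hTc x hx)
    have hfκ : f κ ∈ bb e \ B := hfB ▸ mem_range_self κ
    refine hfκ.2 (hint.2 _ hfκ.1 fun l => ?_)
    choose i hi hUi using hκ
    -- Unavoidability with trivial bounds gives pairs (d j, ξ j) satisfying P that agree with (x, κ)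
    -- on ever longer initial segments.
    choose d _ _ hdx _ ξ hξ hP using fun j => hUi j 0
    have hlim : Tendsto ξ atTop (𝓝 κ) := by
      rw [tendsto_pi_nhds]
      intro a
      refine tendsto_const_nhds.congr' ?_
      filter_upwards [eventually_gt_atTop a] with j hj
      have h1 := hξ j
      rw [length_initSeg] at h1
      exact (eq_of_initSeg_eq h1 hj).symm
    have hlim' : Tendsto (fun j => ‖f (ξ j) l - x l‖) atTop (𝓝 ‖f κ l - x l‖) :=
      (((continuous_apply l).comp hf).continuousAt.tendsto.comp hlim |>.sub_const _).norm
    have hle : ‖f κ l - x l‖ ≤ δ l / 2 := by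
      refine le_of_tendsto hlim' ?_
      filter_upwards [eventually_gt_atTop l] with j hj
      have h1 := hdx j
      rw [length_initSeg] at h1
      rw [← eq_of_initSeg_eq h1 (hj.trans_le (hi j))]
      exact hP j l
    linarith [hδ.2.1 l]
  · left
    rw [Unavoidable, not_forall] at hU
    obtain ⟨M, hM⟩ := hU
    obtain ⟨m, hm, hmM⟩ := exists_strictMono_bound hfin M
    refine ⟨m, hm, fun x hx hR => ⟨hx, fun z hz hzx => ?_⟩⟩
    by_contra hzB
    obtain ⟨κ, rfl⟩ : z ∈ range f := hfB ▸ ⟨hz, hzB⟩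
    have hd := fun i => hπ i (x i) (hx.1 i)
    have hdbb : (fun i => π i (x i)) ∈ bb e := by
      refine ⟨fun i => hnorm i _ (hd i).1, fun i => ?_⟩
      rw [VecLt, (hd i).2.1, (hd (i + 1)).2.1]
      exact hx.2 i
    refine hM ⟨_, hdbb, fun i => (hd i).1, rfl, fun i _ => hmM _ hdbb (fun i => (hd i).1) ?_ i,
      κ, rfl, fun i => ?_⟩
    · intro i
      obtain ⟨j, hj⟩ := hR i
      refine ⟨j, ?_⟩
      simp only [NatLt, LtNat, (hd _).2.1] at hj ⊢
      exact hj
    · have h1 := norm_sub_le_norm_sub_add_norm_sub (f κ i) (x i) (π i (x i))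
      have h2 := hzx i
      have h3 := (hd i).2.2
      linarith

end Main

end AsymptoticGame

open AsymptoticGame in
theorem mainTheorem5 {𝕜 E : Type*} [RCLike 𝕜] [NormedAddCommGroup E] [NormedSpace 𝕜 E]
    (e : Module.Basis ℕ 𝕜 E) (he : ∀ i, ‖e i‖ = 1)
    (B : Set (ℕ → E)) (hB : B ⊆ bb e) (hBco : IsCoanalytic e B) :
    [∃ δ, IsDelta δ ∧ ∃ m : ℕ → ℕ, StrictMono m ∧
        ∀ x ∈ bb e, RelR e m x → x ∈ IntDelta e δ B,
      ∃ δ, IsDelta δ ∧ StrategyI e (IntDelta e δ B),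
      ∃ δ, IsDelta δ ∧ ∀ T, IsBlockTree e T →
        (branches e T ∩ IntDelta e δ B).Nonempty].TFAE ∧
    ((¬ ∃ δ, IsDelta δ ∧ StrategyI e (IntDelta e δ B)) ↔
      ∀ δ, IsDelta δ → StrategyII e (bb e \ IntDelta e δ B)) := by
  have hdelta : ∀ δ, IsDelta δ → IsDelta fun i => δ i / 4 := fun δ h =>
    ⟨fun i j hij => div_le_div_of_nonneg_right (h.1 hij) (by norm_num),
      fun i => div_pos (h.2.1 i) (by norm_num), by simpa using h.2.2.div_const 4⟩
  have hde : (∃ δ, IsDelta δ ∧ ∃ m : ℕ → ℕ, StrictMono m ∧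
      ∀ x ∈ bb e, RelR e m x → x ∈ IntDelta e δ B) →
      ∃ δ, IsDelta δ ∧ StrategyI e (IntDelta e δ B) := by
    rintro ⟨δ, hδ, m, hm, h⟩
    exact ⟨δ, hδ, strategyI_of_relR hm h⟩
  constructor
  · tfae_have 1 → 2 := hde
    tfae_have 2 → 3 := fun ⟨δ, hδ, h⟩ => ⟨δ, hδ, fun T hT => h.branches_inter_nonempty hT⟩
    tfae_have 3 → 1 := by
      rintro ⟨δ, hδ, h⟩
      rcases exists_relR_or_exists_isBlockTree hBco he hδ with ⟨m, hm⟩ | ⟨T, hT, hTB⟩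
      · exact ⟨_, hdelta δ hδ, m, hm⟩
      · obtain ⟨x, hx, hx'⟩ := h T hT
        exact absurd hx' (hTB hx).2
    tfae_finish
  · constructor
    · intro h δ hδ
      rcases exists_relR_or_exists_isBlockTree hBco he hδ with ⟨m, hm⟩ | ⟨T, hT, hTB⟩
      · exact absurd (hde ⟨_, hdelta δ hδ, m, hm⟩) h
      · exact hT.strategyII hTB
    · rintro h ⟨δ, hδ, hI⟩
      exact hI.not_strategyII (h δ hδ)
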